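/- Let $d\ge 1$, let $\Omega\subset\mathbb R^d$ be a bounded polygonal (polyhedral) domain, i.e. a bounded, connected, nonempty open set with $\operatorname{int}\overline\Omega=\Omega$ whose boundary lies in finitely many hyperplanes, and let $\mathcal T_h$ be a finite conforming triangulation of $\overline\Omega$ into nondegenerate closed $d$-simplices. Let $\mathcal E_h^i$ be the set of interior edges (faces if $d=3$) $e=\partial K\cap\partial L$, i.e. the $(d-1)$-simplices shared by two different elements $K,L\in\mathcal T_h$; for each of them the order of $K$ and $L$ is fixed arbitrarily, and $\boldsymbol n_e$ denotes the unit normal to $e$ exterior to $K$ and pointing to $L$. Let $\boldsymbol\beta\colon\overline\Omega\to\mathbb R^d$ be continuous with $\boldsymbol\beta\cdot\boldsymbol n=0$ on $\partial\Omega$ (at the points where the outward unit normal $\boldsymbol n$ exists), and let $\Delta t>0$. Let $\mathcal S_h=\mathbb P_0^{\rm disc}(\mathcal T_h)$ be the space of functions that are constant on (the interior of) each element of $\mathcal T_h$. Write $a_\oplus=\max\{a,0\}$ and $a_\ominus=-\min\{a,0\}$, let $v_K$ denote the trace on $K$ of a piecewise smooth function $v$, and for $e=\partial K\cap\partial L\in\mathcal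 E_h^i$ put $[\![\overline v]\!]=\overline v_K-\overline v_L$. Define the upwind form $$a_h^{\rm upw}(\boldsymbol\beta;v,\overline v)=-\sum_{K\in\mathcal T_h}\int_K v\,(\boldsymbol\beta\cdot\nabla\overline v)+\sum_{e\in\mathcal E_h^i,\ e=\partial K\cap\partial L}\int_e\big((\boldsymbol\beta\cdot\boldsymbol n_e)_\oplus v_K-(\boldsymbol\beta\cdot\boldsymbol n_e)_\ominus v_L\big)[\![\overline v]\!].$$ Then for every $v^m\in\mathcal S_h$ (of any sign) there exists at least one solution $v^{m+1}\in\mathcal S_h$ of the truncated upwind scheme $$\int_\Omega\frac{v^{m+1}-v^m}{\Delta t}\,\overline v+a_h^{\rm upw}(\boldsymbol\beta;v^{m+1}_\oplus,\overline v)=0\qquad\text{for all }\overline v\in\mathcal S_h .$$ -/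

import Mathlib

open MeasureTheory Set Topology

noncomputable section

namespace UpwindDG

/-- The space `ℝ^d` with its Euclidean structure. -/
abbrev E (d : ℕ) : Type := EuclideanSpace ℝ (Fin d)

/-- The (closed) region `conv s` spanned by a finite set of vertices. -/
def hull {d : ℕ} (s : Finset (E d)) : Set (E d) := convexHull ℝ (s : Set (E d))

/-- A bounded polygonal (polyhedral) domain: a bounded, connected, nonempty open set which coincides
with the interior of its closure and whose boundary lies in a finite union of hyperplanes. -/
structure IsPolygonalDomain {d : ℕ} (Ω : Set (E d)) : Prop where
  isOpen : IsOpen Ω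
  isConnected : IsConnected Ω
  isBounded : Bornology.IsBounded Ω
  interior_closure : interior (closure Ω) = Ω
  frontier_subset : ∃ H : Finset (E d × ℝ), (∀ h ∈ H, h.1 ≠ 0) ∧
    frontier Ω ⊆ ⋃ h ∈ H, {x : E d | inner ℝ h.1 x = h.2}

/-- `n` is the unit normal of `Ω` at the (flat) boundary point `x`, pointing outwards: near `x` the
set `Ω` is the open half space `{y | n · (y - x) < 0}`. -/
def IsOutwardUnitNormal {d : ℕ} (Ω : Set (E d)) (x n : E d) : Prop :=
  ‖n‖ = 1 ∧ ∀ᶠ y in 𝓝 x, (y ∈ Ω ↔ inner ℝ n (y - x) < 0)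

/-- The slip condition `β · n = 0` on `∂Ω`. -/
def SlipCondition {d : ℕ} (Ω : Set (E d)) (β : E d → E d) : Prop :=
  ∀ x ∈ frontier Ω, ∀ n : E d, IsOutwardUnitNormal Ω x n → inner ℝ (β x) n = 0

/-- A (conforming) triangulation of `Ω`: a finite simplicial complex, all of whose simplices are
faces of `d`-dimensional simplices, and which covers exactly the closure of `Ω`. -/
structure Triangulation {d : ℕ} (Ω : Set (E d)) extends Geometry.SimplicialComplex ℝ (E d) where
  finite_faces : faces.Finite
  pure : ∀ s ∈ faces, ∃ t ∈ faces, s ⊆ t ∧ t.card = d + 1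
  space_eq : toSimplicialComplex.space = closure Ω

variable {d : ℕ} {Ω : Set (E d)}

open Classical in
/-- The elements `K ∈ 𝒯_h` (each given by its `d + 1` vertices). -/
def Triangulation.elements (T : Triangulation Ω) : Finset (Finset (E d)) :=
  T.finite_faces.toFinset.filter fun s => s.card = d + 1

open Classical in
/-- The interior edges (faces if `d = 3`) `e ∈ ℰ_h^i`, each given by its `d` vertices: those shared
by two different elements. -/
def Triangulation.interiorEdges (T : Triangulation Ω) : Finset (Finset (E d)) :=
  T.finite_faces.toFinset.filter fun e => e.card = d ∧
    ∃ K ∈ T.elements, ∃ L ∈ T.elements, K ≠ L ∧ e ⊆ K ∧ e ⊆ L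

/-- A choice of orientation of the interior edges: each interior edge `e` is written as the edge
shared by an element `K e` and an element `L e`, in this order. -/
structure Orientation (T : Triangulation Ω) where
  K : Finset (E d) → Finset (E d)
  L : Finset (E d) → Finset (E d)
  K_mem : ∀ e ∈ T.interiorEdges, K e ∈ T.elements
  L_mem : ∀ e ∈ T.interiorEdges, L e ∈ T.elements
  K_ne_L : ∀ e ∈ T.interiorEdges, K e ≠ L e
  subset_K : ∀ e ∈ T.interiorEdges, e ⊆ K e
  subset_L : ∀ e ∈ T.interiorEdges, e ⊆ L e

/-- The unit normal to the edge `e` of the simplex `K`, exterior to `K`: the component orthogonal to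
`e` of the vector from the centroid of `K` to the centroid of `e`, normalized. -/
def outwardNormal (K e : Finset (E d)) : E d :=
  let w : E d := ((vectorSpan ℝ (e : Set (E d)))ᗮ).starProjection
    (e.centroid ℝ id - K.centroid ℝ id)
  ‖w‖⁻¹ • w

/-- The normal `n_e` to an interior edge, exterior to `K` and pointing to `L`. -/
def Orientation.normal {T : Triangulation Ω} (o : Orientation T) (e : Finset (E d)) : E d :=
  outwardNormal (o.K e) e

/-- `ℙ_k^disc(𝒯_h)`: functions whose restriction to (the interior of) every element is a polynomial
of degree at most `k`. The values on the skeleton of the mesh and outside the mesh are irrelevant. -/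
def Pdisc (T : Triangulation Ω) (k : ℕ) : Set (E d → ℝ) :=
  {v | ∀ K ∈ T.elements, ∃ p : MvPolynomial (Fin d) ℝ, p.totalDegree ≤ k ∧
    ∀ x ∈ interior (hull K), v x = MvPolynomial.eval (fun i => x i) p}

/-- The trace `v_K` on `K` of a piecewise continuous function: the continuous extension to the
closed element `K` of the restriction of `v` to the interior of `K`. -/
def trace (K : Finset (E d)) (v : E d → ℝ) : E d → ℝ := extendFrom (interior (hull K)) v

/-- The positive part `a_⊕ = (|a| + a) / 2` of a number. -/
def pos (a : ℝ) : ℝ := max a 0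

/-- The negative part `a_⊖ = (|a| - a) / 2` of a number. -/
def neg (a : ℝ) : ℝ := -min a 0

/-- The upwind form
`a(β; v, v̄) = - ∑_K ∫_K v (β · ∇v̄) + ∑_{e = K ∩ L} ∫_e ((β·n_e)_⊕ v_K - (β·n_e)_⊖ v_L) ⟦v̄⟧`,
with `⟦v̄⟧ = v̄_K - v̄_L`; the integrals over edges are with respect to the `(d-1)`-dimensional
surface measure. -/
def aupw (T : Triangulation Ω) (o : Orientation T) (β : E d → E d) (v w : E d → ℝ) : ℝ :=
  -(∑ K ∈ T.elements, ∫ x in hull K, v x * inner ℝ (β x) (gradient w x)) +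
    ∑ e ∈ T.interiorEdges, ∫ x in hull e,
      (pos (inner ℝ (β x) (o.normal e)) * trace (o.K e) v x
          - neg (inner ℝ (β x) (o.normal e)) * trace (o.L e) v x)
        * (trace (o.K e) w x - trace (o.L e) w x) ∂μHE[d - 1]

/-- `v = v^{m+1}` is a solution in `𝒮_h = ℙ_k^disc(𝒯_h)` of the truncated upwind scheme with time
step `Δt`, starting from `vm = v^m`:
`∫_Ω ((v - vm) / Δt) v̄ + a(β; v_⊕, v̄) = 0` for all `v̄ ∈ 𝒮_h`. -/
def IsSchemeSolution (T : Triangulation Ω) (o : Orientation T) (β : E d → E d) (Δt : ℝ) (k : ℕ)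
    (vm v : E d → ℝ) : Prop :=
  v ∈ Pdisc T k ∧ ∀ w ∈ Pdisc T k,
    (∫ x in Ω, (v x - vm x) / Δt * w x) + aupw T o β (fun x => pos (v x)) w = 0

end UpwindDG

end

open MeasureTheory Set Topology

noncomputable section

namespace UpwindDG

/-! On piecewise constants the volume term vanishes and the scheme becomes one balance per element,
m_i (x_i - y_i) + outflow - inflow = 0, whose edge fluxes have nonnegative coefficients
(`aupw_eq_of_const`, `setIntegral_eq_sum_of_const`). With α_i the sum of the outflow coefficients of
i, take z_i = m_i x_i + α_i pos(x_i) as unknown. This is an increasing bijection of x_i, and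
pos(x_i) = pos(z_i) / (m_i + α_i), so the system reads z = G(z) with G the data plus the inflow.
What leaves one element enters another, so in the ℓ¹ norm G is Lipschitz with constant max α_i /
(m_i + α_i) < 1, and Banach's theorem gives a solution (`exists_upwind_flux_solution`). -/

lemma pos_nonneg (a : ℝ) : 0 ≤ pos a := le_max_right _ _

lemma abs_pos_sub_pos_le (a b : ℝ) : |pos a - pos b| ≤ |a - b| :=
  abs_max_sub_max_le_abs a b 0

/-- A positive-diagonal system with a nonlinear upwind flux on a finite graph has a solution. -/
lemma exists_upwind_flux_solution {ι κ : Type*} [Fintype ι] [Fintype κ] [DecidableEq ι]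
    (k l : κ → ι) (a b : κ → ℝ) (ha : ∀ e, 0 ≤ a e) (hb : ∀ e, 0 ≤ b e)
    (m : ι → ℝ) (hm : ∀ i, 0 < m i) (y : ι → ℝ) :
    ∃ x : ι → ℝ, ∀ i, m i * (x i - y i) +
      ∑ e, (a e * pos (x (k e)) - b e * pos (x (l e))) *
        ((if k e = i then 1 else 0) - (if l e = i then 1 else 0)) = 0 := by
  classical
  let α : ι → ℝ := fun i =>
    ∑ e, (a e * (if k e = i then 1 else 0) + b e * (if l e = i then 1 else 0))
  have hα : ∀ i, 0 ≤ α i := fun i => Finset.sum_nonneg fun e _ => by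
    have := ha e; have := hb e; positivity
  have hmα : ∀ i, 0 < m i + α i := fun i => add_pos_of_pos_of_nonneg (hm i) (hα i)
  -- The value of pos(x_i) expressed through z_i = m_i x_i + α_i pos(x_i).
  let u : PiLp 1 (fun _ : ι => ℝ) → ι → ℝ := fun z i => pos (z i) / (m i + α i)
  let G : PiLp 1 (fun _ : ι => ℝ) → PiLp 1 (fun _ : ι => ℝ) := fun z =>
    WithLp.toLp 1 fun i => m i * y i +
      ∑ e, (a e * u z (k e) * (if l e = i then 1 else 0)
        + b e * u z (l e) * (if k e = i then 1 else 0))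
  obtain ⟨r, hr0, hr1, hr⟩ : ∃ r : ℝ, 0 ≤ r ∧ r < 1 ∧ ∀ i, α i / (m i + α i) ≤ r := by
    have h1 : ∀ i, α i / (m i + α i) < 1 := fun i => by
      rw [div_lt_one (hmα i)]; linarith [hm i]
    rcases isEmpty_or_nonempty ι with h | h
    · exact ⟨0, le_rfl, one_pos, fun i => h.elim i⟩
    · obtain ⟨i, hi⟩ := Finite.exists_max fun i => α i / (m i + α i)
      exact ⟨_, div_nonneg (hα i) (hmα i).le, h1 i, hi⟩
  have hu : ∀ z z' i, |u z i - u z' i| ≤ |z i - z' i| / (m i + α i) := fun z z' i => by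
    simp only [u]
    rw [← sub_div, abs_div, abs_of_pos (hmα i)]
    exact div_le_div_of_nonneg_right (abs_pos_sub_pos_le _ _) (hmα i).le
  have hdist : ∀ z z' : PiLp 1 (fun _ : ι => ℝ), dist z z' = ∑ i, |z i - z' i| := fun z z' => by
    rw [PiLp.dist_eq_of_L1]; rfl
  have hG : ContractingWith ⟨r, hr0⟩ G := by
    refine ⟨by exact_mod_cast hr1, LipschitzWith.of_dist_le_mul fun z z' => ?_⟩
    rw [hdist, hdist]
    calc ∑ i, |G z i - G z' i|
        ≤ ∑ i, ∑ e, (a e * |u z (k e) - u z' (k e)| * (if l e = i then 1 else 0)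
          + b e * |u z (l e) - u z' (l e)| * (if k e = i then 1 else 0)) := by
          refine Finset.sum_le_sum fun i _ => ?_
          have : G z i - G z' i =
              ∑ e, (a e * (u z (k e) - u z' (k e)) * (if l e = i then 1 else 0)
                + b e * (u z (l e) - u z' (l e)) * (if k e = i then 1 else 0)) := by
            simp only [G, add_sub_add_left_eq_sub, ← Finset.sum_sub_distrib]
            exact Finset.sum_congr rfl fun e _ => by ring
          rw [this]
          refine (Finset.abs_sum_le_sum_abs _ _).trans (Finset.sum_le_sum fun e _ => ?_)
          refine (abs_add_le _ _).trans_eq ?_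
          simp only [abs_mul, abs_of_nonneg (ha e), abs_of_nonneg (hb e)]
          split_ifs <;> simp
      -- Each flux enters exactly one vertex, so summing over i counts it once; the next step
      -- regroups by the vertex it leaves, which produces α. This is where ℓ¹ is needed.
      _ = ∑ e, (a e * |u z (k e) - u z' (k e)| + b e * |u z (l e) - u z' (l e)|) := by
          rw [Finset.sum_comm]
          refine Finset.sum_congr rfl fun e _ => ?_
          simp [Finset.sum_add_distrib]
      _ = ∑ i, α i * |u z i - u z' i| := by
          simp only [α, Finset.sum_mul]
          rw [Finset.sum_comm]
          refine Finset.sum_congr rfl fun e _ => ?_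
          simp [add_mul, Finset.sum_add_distrib]
      _ ≤ ∑ i, r * |z i - z' i| := by
          refine Finset.sum_le_sum fun i _ => ?_
          calc α i * |u z i - u z' i| ≤ α i * (|z i - z' i| / (m i + α i)) :=
                mul_le_mul_of_nonneg_left (hu z z' i) (hα i)
            _ = α i / (m i + α i) * |z i - z' i| := by ring
            _ ≤ r * |z i - z' i| := mul_le_mul_of_nonneg_right (hr i) (abs_nonneg _)
      _ = r * ∑ i, |z i - z' i| := (Finset.mul_sum _ _ _).symm
  obtain ⟨z, hz, -⟩ := hG.exists_fixedPoint 0 (edist_ne_top _ _)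
  have hzi : ∀ i, z i = m i * y i + ∑ e, (a e * u z (k e) * (if l e = i then 1 else 0)
        + b e * u z (l e) * (if k e = i then 1 else 0)) := fun i =>
    (congrArg (fun z : PiLp 1 (fun _ : ι => ℝ) => z i) hz).symm
  -- Inverts the substitution: x_i = z_i / m_i if z_i ≤ 0, and z_i / (m_i + α_i) otherwise.
  let x : ι → ℝ := fun i => (z i - α i * u z i) / m i
  have hx : ∀ i, pos (x i) = u z i := fun i => by
    have h1 := hm i
    have h2 := hmα i
    rcases le_total (z i) 0 with h | h
    · have hu0 : u z i = 0 := by simp [u, pos, max_eq_right h]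
      simp only [x, hu0, mul_zero, sub_zero]
      exact max_eq_right (div_nonpos_of_nonpos_of_nonneg h h1.le)
    · have hu0 : u z i = z i / (m i + α i) := by simp [u, pos, max_eq_left h]
      have hxi : x i = z i / (m i + α i) := by
        simp only [x, hu0]; field_simp; ring
      rw [hxi, hu0]
      exact max_eq_left (div_nonneg h h2.le)
  refine ⟨x, fun i => ?_⟩
  have hmx : m i * x i = z i - α i * u z i := mul_div_cancel₀ _ (hm i).ne'
  rw [mul_sub, hmx, hzi i]
  simp only [hx, α, Finset.sum_mul]
  -- Edge by edge: outflow from i minus inflow into i. It also holds for loops, where both sides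
  -- vanish.
  have : ∀ e, (a e * u z (k e) - b e * u z (l e)) *
        ((if k e = i then 1 else 0) - (if l e = i then 1 else 0)) =
      (a e * (if k e = i then 1 else 0) + b e * (if l e = i then 1 else 0)) * u z i
      - (a e * u z (k e) * (if l e = i then 1 else 0)
        + b e * u z (l e) * (if k e = i then 1 else 0)) := fun e => by
    split_ifs with h1 h2 h2 <;> simp_all; ring
  rw [Finset.sum_congr rfl fun e _ => this e, Finset.sum_sub_distrib]
  ring
-- Geometry of the mesh
variable {d : ℕ} {Ω : Set (E d)}

lemma convex_hull (s : Finset (E d)) : Convex ℝ (hull s) := convex_convexHull ℝ _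

lemma isCompact_hull (s : Finset (E d)) : IsCompact (hull s) :=
  s.finite_toSet.isCompact_convexHull ℝ

lemma hull_mono {s t : Finset (E d)} (h : s ⊆ t) : hull s ⊆ hull t :=
  convexHull_mono (Finset.coe_subset.2 h)

lemma hull_ae_eq_interior (s : Finset (E d)) : interior (hull s) =ᵐ[volume] hull s :=
  interior_ae_eq_of_null_frontier ((convex_hull s).addHaar_frontier volume)

/-- At most d points span an affine subspace of dimension less than d, whereas a set with interior
points spans everything. -/
lemma interior_hull_eq_empty {s : Finset (E d)} (h : s.card ≤ d) : interior (hull s) = ∅ := by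
  by_contra hne
  have htop := affineSpan_eq_top_of_nonempty_interior (nonempty_iff_ne_empty.2 hne)
  rcases s.eq_empty_or_nonempty with rfl | hs
  · simp [hull] at hne
  · obtain ⟨n, hn⟩ : ∃ n, s.card = n + 1 := ⟨s.card - 1, by have := hs.card_pos; omega⟩
    have h1 : Module.finrank ℝ (vectorSpan ℝ (s : Set (E d))) ≤ n := by
      classical
      have := finrank_vectorSpan_image_finset_le ℝ (id : E d → E d) s hn
      rwa [Finset.image_id] at this
    rw [← direction_affineSpan, htop, AffineSubspace.direction_top, finrank_top,
      finrank_euclideanSpace_fin] at h1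
    omega

namespace Triangulation

variable (T : Triangulation Ω)

lemma mem_elements {K : Finset (E d)} : K ∈ T.elements ↔ K ∈ T.faces ∧ K.card = d + 1 := by
  simp [elements]

lemma mem_faces_of_mem_interiorEdges {e : Finset (E d)} (he : e ∈ T.interiorEdges) :
    e ∈ T.faces ∧ e.card = d := by
  simp only [interiorEdges, Finset.mem_filter, Set.Finite.mem_toFinset] at he
  exact ⟨he.1, he.2.1⟩

lemma interior_hull_nonempty {K : Finset (E d)} (hK : K ∈ T.elements) :
    (interior (hull K)).Nonempty := by
  obtain ⟨hK, hc⟩ := T.mem_elements.1 hK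
  refine interior_convexHull_nonempty_iff_affineSpan_eq_top.2 ?_
  have := (T.indep hK).affineSpan_eq_top_iff_card_eq_finrank_add_one.2 (by simp [hc])
  simpa using this

/-- By conformity the two simplices meet inside the hull of their common vertices, of which there
are at most d. -/
lemma disjoint_interior_hull {K L : Finset (E d)} (hK : K ∈ T.elements) (hL : L ∈ T.elements)
    (hKL : K ≠ L) : Disjoint (interior (hull K)) (interior (hull L)) := by
  classical
  obtain ⟨hK, hKc⟩ := T.mem_elements.1 hK
  obtain ⟨hL, hLc⟩ := T.mem_elements.1 hL
  rw [Set.disjoint_iff_inter_eq_empty, ← interior_inter]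
  have hsub : hull K ∩ hull L ⊆ hull (K ∩ L) := by
    simpa [hull] using T.inter_subset_convexHull hK hL
  have hcard : (K ∩ L).card ≤ d := by
    by_contra! hlt
    have h1 : K ∩ L = K := Finset.eq_of_subset_of_card_le Finset.inter_subset_left (by omega)
    have h2 : K ∩ L = L := Finset.eq_of_subset_of_card_le Finset.inter_subset_right (by omega)
    exact hKL (h1.symm.trans h2)
  exact subset_eq_empty (interior_mono hsub) (interior_hull_eq_empty hcard)

lemma iUnion_hull_elements : ⋃ K ∈ T.elements, hull K = closure Ω := by
  rw [← T.space_eq]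
  refine Subset.antisymm (iUnion₂_subset fun K hK => ?_) fun x hx => ?_
  · exact Geometry.SimplicialComplex.convexHull_subset_space (T.mem_elements.1 hK).1
  · obtain ⟨s, hs, hxs⟩ := Geometry.SimplicialComplex.mem_space_iff.1 hx
    obtain ⟨t, ht, hst, hc⟩ := T.pure s hs
    exact mem_iUnion₂.2 ⟨t, T.mem_elements.2 ⟨ht, hc⟩, hull_mono hst hxs⟩

/-- The closed elements cover Ω, and the boundary of a convex set is null. -/
lemma iUnion_interior_hull_ae_eq (hΩ : interior (closure Ω) = Ω) :
    (⋃ K ∈ T.elements, interior (hull K) : Set (E d)) =ᵐ[volume] Ω := by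
  have hsub : ⋃ K ∈ T.elements, interior (hull K) ⊆ Ω := by
    refine (iUnion₂_subset fun K hK => interior_mono ?_).trans hΩ.subset
    rw [← T.iUnion_hull_elements]
    exact subset_biUnion_of_mem (u := hull) hK
  refine hsub.eventuallyLE.antisymm ?_
  have hle : Ω ⊆ ⋃ K ∈ T.elements, hull K := by
    rw [T.iUnion_hull_elements]; exact subset_closure
  refine hle.eventuallyLE.trans (Filter.EventuallyEq.le ?_)
  exact (Filter.EventuallyEq.countable_bUnion T.elements.countable_toSet
    fun K _ => hull_ae_eq_interior K).symm

end Triangulation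

/-! ### Piecewise constant functions and the upwind form -/

lemma exists_const_of_mem_Pdisc_zero {T : Triangulation Ω} {v : E d → ℝ} (hv : v ∈ Pdisc T 0) :
    ∃ c : Finset (E d) → ℝ, ∀ K ∈ T.elements, ∀ x ∈ interior (hull K), v x = c K := by
  choose! p hp hpv using hv
  refine ⟨fun K => (p K).coeff 0, fun K hK x hx => ?_⟩
  rw [hpv K hK x hx, MvPolynomial.totalDegree_eq_zero_iff_eq_C.1 (Nat.le_zero.1 (hp K hK))]
  simp

lemma exists_mem_Pdisc_zero (T : Triangulation Ω) (c : Finset (E d) → ℝ) :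
    ∃ v ∈ Pdisc T 0, ∀ K ∈ T.elements, ∀ x ∈ interior (hull K), v x = c K := by
  classical
  have key : ∀ K ∈ T.elements, ∀ x ∈ interior (hull K),
      ∑ L ∈ T.elements, (interior (hull L)).indicator (fun _ => c L) x = c K := by
    intro K hK x hx
    rw [Finset.sum_eq_single_of_mem K hK, indicator_of_mem hx]
    intro L hL hLK
    exact indicator_of_notMem
      (fun hxL => (T.disjoint_interior_hull hL hK hLK).ne_of_mem hxL hx rfl) _
  exact ⟨_, fun K hK => ⟨MvPolynomial.C (c K), by simp, fun x hx => by simp [key K hK x hx]⟩, key⟩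

lemma trace_eq_of_const {T : Triangulation Ω} {K : Finset (E d)} (hK : K ∈ T.elements)
    {v : E d → ℝ} {c : ℝ} (hv : ∀ x ∈ interior (hull K), v x = c) {x : E d} (hx : x ∈ hull K) :
    trace K v x = c := by
  refine extendFrom_eq ?_ (tendsto_const_nhds.congr' ?_)
  · rw [(convex_hull K).closure_interior_eq_closure_of_nonempty_interior
      (T.interior_hull_nonempty hK)]
    exact subset_closure hx
  · filter_upwards [self_mem_nhdsWithin] with y hy using (hv y hy).symm

/-- The gradient is uncontrolled only on the null boundary of K; inside, w is locally constant. -/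
lemma setIntegral_mul_gradient_eq_zero {K : Finset (E d)} {w : E d → ℝ} {c : ℝ}
    (hw : ∀ x ∈ interior (hull K), w x = c) (β : E d → E d) (v : E d → ℝ) :
    ∫ x in hull K, v x * inner ℝ (β x) (gradient w x) = 0 := by
  rw [← setIntegral_congr_set (hull_ae_eq_interior K)]
  refine setIntegral_eq_zero_of_forall_eq_zero fun x hx => ?_
  have hloc : w =ᶠ[𝓝 x] fun _ => c := by
    filter_upwards [isOpen_interior.mem_nhds hx] with y hy using hw y hy
  rw [hloc.gradient_eq, gradient_fun_const]
  simp

lemma setIntegral_eq_sum_of_const (T : Triangulation Ω) (hΩ : interior (closure Ω) = Ω)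
    {f : E d → ℝ} {c : Finset (E d) → ℝ}
    (hf : ∀ K ∈ T.elements, ∀ x ∈ interior (hull K), f x = c K) :
    ∫ x in Ω, f x = ∑ K ∈ T.elements, volume.real (hull K) * c K := by
  have hfin : ∀ K : Finset (E d), volume (interior (hull K)) ≠ ⊤ := fun K =>
    ((measure_mono interior_subset).trans_lt (isCompact_hull K).measure_lt_top).ne
  rw [← setIntegral_congr_set (T.iUnion_interior_hull_ae_eq hΩ),
    integral_biUnion_finset _ (fun _ _ => isOpen_interior.measurableSet)
      (fun K hK L hL h => T.disjoint_interior_hull hK hL h)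
      (fun K hK => ((integrableOn_const (hfin K)).congr_fun
        (fun x hx => (hf K hK x hx).symm) isOpen_interior.measurableSet))]
  refine Finset.sum_congr rfl fun K hK => ?_
  rw [setIntegral_congr_fun isOpen_interior.measurableSet (hf K hK), setIntegral_const,
    measureReal_congr (hull_ae_eq_interior K), smul_eq_mul]

lemma measureReal_hull_pos {T : Triangulation Ω} {K : Finset (E d)} (hK : K ∈ T.elements) :
    0 < volume.real (hull K) :=
  ENNReal.toReal_pos (Measure.measure_pos_of_nonempty_interior _ (T.interior_hull_nonempty hK)).ne'
    (isCompact_hull K).measure_lt_top.ne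

/-- A simplex with `n + 1` vertices has finite `n`-dimensional surface measure. -/
lemma euclideanHausdorffMeasure_hull_lt_top {e : Finset (E d)}
    (hind : AffineIndependent ℝ ((↑) : e → E d)) {n : ℕ} (hn : e.card = n + 1) :
    μHE[n] (hull e) < ⊤ := by
  obtain ⟨p, hp⟩ : e.Nonempty := Finset.card_pos.1 (by omega)
  let V := vectorSpan ℝ (e : Set (E d))
  have hV : Module.finrank ℝ V = n := by
    have hr : vectorSpan ℝ (range ((↑) : e → E d)) = V := congrArg _ Subtype.range_coe
    exact (LinearEquiv.ofEq _ _ hr).finrank_eq.symm.trans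
      (hind.finrank_vectorSpan (by simpa using hn))
  -- The simplex lies in an isometric copy of its n-dimensional direction space V, where `μHE[n]` is
  -- finite on compact sets.
  let f : V → E d := fun x => (x : E d) + p
  have hf : Isometry f := (IsometryEquiv.addRight p).isometry.comp isometry_subtype_coe
  have hsub : hull e ⊆ f '' (f ⁻¹' hull e) := by
    refine fun x hx => (image_preimage_eq_inter_range (f := f)).ge ⟨hx, ?_⟩
    refine ⟨⟨x - p, ?_⟩, by simp [f]⟩
    rw [← vsub_eq_sub]
    exact vsub_mem_vectorSpan_of_mem_affineSpan_of_mem_affineSpan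
      (convexHull_subset_affineSpan _ hx) (mem_affineSpan ℝ hp)
  refine (measure_mono hsub).trans_lt ?_
  rw [hf.euclideanHausdorffMeasure_image, ← hV]
  exact (hf.isClosedEmbedding.isCompact_preimage (isCompact_hull e)).measure_lt_top

lemma neg_nonneg (a : ℝ) : 0 ≤ neg a := by simp [neg]

lemma continuous_pos : Continuous pos := by unfold pos; fun_prop

lemma continuous_neg : Continuous neg := by unfold neg; fun_prop

/-- The upwind form on piecewise constant functions. -/
lemma aupw_eq_of_const (T : Triangulation Ω) (o : Orientation T) {β : E d → E d} (hd : 1 ≤ d)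
    (hβ : ContinuousOn β (closure Ω)) {v w : E d → ℝ} {cv cw : Finset (E d) → ℝ}
    (hv : ∀ K ∈ T.elements, ∀ x ∈ interior (hull K), v x = cv K)
    (hw : ∀ K ∈ T.elements, ∀ x ∈ interior (hull K), w x = cw K) :
    aupw T o β v w = ∑ e ∈ T.interiorEdges,
      ((∫ x in hull e, pos (inner ℝ (β x) (o.normal e)) ∂μHE[d - 1]) * cv (o.K e)
        - (∫ x in hull e, neg (inner ℝ (β x) (o.normal e)) ∂μHE[d - 1]) * cv (o.L e))
        * (cw (o.K e) - cw (o.L e)) := by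
  rw [aupw, Finset.sum_eq_zero fun K hK => setIntegral_mul_gradient_eq_zero (hw K hK) β v,
    neg_zero, zero_add]
  refine Finset.sum_congr rfl fun e he => ?_
  obtain ⟨hef, hec⟩ := T.mem_faces_of_mem_interiorEdges he
  -- The d vertices number (d - 1) + 1 because d ≥ 1.
  have hfin : μHE[d - 1] (hull e) < ⊤ :=
    euclideanHausdorffMeasure_hull_lt_top (T.indep hef) (by omega)
  have hm : MeasurableSet (hull e) := (isCompact_hull e).measurableSet
  have hsub : hull e ⊆ closure Ω := by
    rw [← T.space_eq]; exact Geometry.SimplicialComplex.convexHull_subset_space hef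
  have hc : ContinuousOn (fun x => inner ℝ (β x) (o.normal e)) (hull e) :=
    (hβ.mono hsub).inner continuousOn_const
  have hint : ∀ g : ℝ → ℝ, Continuous g →
      IntegrableOn (fun x => g (inner ℝ (β x) (o.normal e))) (hull e) μHE[d - 1] := fun g hg => by
    have hgc := hg.comp_continuousOn hc
    obtain ⟨C, hC⟩ := (isCompact_hull e).exists_bound_of_continuousOn hgc
    exact IntegrableOn.of_bound hfin (hgc.aestronglyMeasurable_of_isCompact (isCompact_hull e) hm) C
      (ae_restrict_of_forall_mem hm hC)
  have hK := o.K_mem e he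
  have hL := o.L_mem e he
  rw [← integral_mul_const, ← integral_mul_const, ← integral_sub
    ((hint _ continuous_pos).mul_const _) ((hint _ continuous_neg).mul_const _),
    ← integral_mul_const]
  refine setIntegral_congr_fun hm fun x hx => ?_
  have hxK := hull_mono (o.subset_K e he) hx
  have hxL := hull_mono (o.subset_L e he) hx
  simp only [trace_eq_of_const hK (hv _ hK) hxK, trace_eq_of_const hL (hv _ hL) hxL,
    trace_eq_of_const hK (hw _ hK) hxK, trace_eq_of_const hL (hw _ hL) hxL]

end UpwindDG

end

theorem mainTheorem5 (d : ℕ) (hd : 1 ≤ d) (Ω : Set (UpwindDG.E d))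
    (hΩ : UpwindDG.IsPolygonalDomain Ω)
    (T : UpwindDG.Triangulation Ω) (o : UpwindDG.Orientation T)
    (β : UpwindDG.E d → UpwindDG.E d) (hβ : ContinuousOn β (closure Ω))
    (hslip : UpwindDG.SlipCondition Ω β)
    (Δt : ℝ) (hΔt : 0 < Δt)
    (vm : UpwindDG.E d → ℝ) (hvm : vm ∈ UpwindDG.Pdisc T 0) :
    ∃ v : UpwindDG.E d → ℝ, UpwindDG.IsSchemeSolution T o β Δt 0 vm v := by
  classical
  obtain ⟨y, hy⟩ := UpwindDG.exists_const_of_mem_Pdisc_zero hvm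
  let a : UpwindDG.E d → Finset (UpwindDG.E d) → ℝ := fun x e => inner ℝ (β x) (o.normal e)
  let A : Finset (UpwindDG.E d) → ℝ := fun e =>
    ∫ x in UpwindDG.hull e, UpwindDG.pos (a x e) ∂μHE[d - 1]
  let B : Finset (UpwindDG.E d) → ℝ := fun e =>
    ∫ x in UpwindDG.hull e, UpwindDG.neg (a x e) ∂μHE[d - 1]
  obtain ⟨x, hx⟩ := UpwindDG.exists_upwind_flux_solution
    (ι := T.elements) (κ := T.interiorEdges)
    (fun e => ⟨o.K e, o.K_mem e e.2⟩) (fun e => ⟨o.L e, o.L_mem e e.2⟩)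
    (fun e => A e) (fun e => B e)
    (fun e => integral_nonneg fun _ => UpwindDG.pos_nonneg _)
    (fun e => integral_nonneg fun _ => UpwindDG.neg_nonneg _)
    (fun K => volume.real (UpwindDG.hull (K : Finset (UpwindDG.E d))) / Δt)
    (fun K => div_pos (UpwindDG.measureReal_hull_pos K.2) hΔt) (fun K => y K)
  let c : Finset (UpwindDG.E d) → ℝ := fun K => if h : K ∈ T.elements then x ⟨K, h⟩ else 0
  have hc : ∀ K : T.elements, x K = c K := fun K => by simp [c]
  obtain ⟨v, hv, hvc⟩ := UpwindDG.exists_mem_Pdisc_zero T c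
  refine ⟨v, hv, fun w hw => ?_⟩
  obtain ⟨z, hz⟩ := UpwindDG.exists_const_of_mem_Pdisc_zero hw
  rw [UpwindDG.setIntegral_eq_sum_of_const T hΩ.interior_closure
      (c := fun K => (c K - y K) / Δt * z K)
      (fun K hK p hp => by rw [hvc K hK p hp, hy K hK p hp, hz K hK p hp]),
    UpwindDG.aupw_eq_of_const T o hd hβ (cv := fun K => UpwindDG.pos (c K))
      (fun K hK p hp => by rw [hvc K hK p hp]) hz]
  -- Weighting the balance of each K by the test value z K and summing gives the scheme tested with
  -- w.
  have hsum := Finset.sum_eq_zero fun (K : T.elements) (_ : K ∈ Finset.univ) =>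
    (mul_eq_zero_of_left (hx K) (z K) :)
  simp only [add_mul, Finset.sum_add_distrib, Finset.sum_mul, hc] at hsum
  rw [Finset.sum_comm] at hsum
  rw [← hsum, ← Finset.sum_coe_sort T.elements, ← Finset.sum_coe_sort T.interiorEdges]
  congr 1
  · exact Finset.sum_congr rfl fun K _ => by ring
  -- Summed against z, the two indicators of an edge collapse to the jump z K - z L.
  · refine Finset.sum_congr rfl fun e _ => ?_
    simp only [mul_assoc, ← Finset.mul_sum, sub_mul, Finset.sum_sub_distrib, ite_mul, one_mul,
      zero_mul, Finset.sum_ite_eq, Finset.mem_univ, if_true]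
    rfl
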